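/- Let $n\ge 1$ and let $\vartheta$ be a mixture on $[n]$, i.e. a Borel probability measure on the simplex $\Delta_n=\{x\in\mathbb{R}^n : x_i\ge 0 \text{ for all } i,\ \sum_{i=1}^n x_i=1\}$, regarded as a measure on $\mathbb{R}^n$. Assume that $\vartheta$ is isotropic, i.e. $r_i:=\int x_i\,\vartheta(dx)\in\left[\frac{1}{2n},\frac{2}{n}\right]$ for every $i\in\{1,\dots,n\}$. For $C\in\mathbb{R}$ let $\mathcal{H}=[-C/n,\,C/n]^n\subset\mathbb{R}^n$. Then for every integer $k\ge 0$ and every $\varepsilon>0$ the following hold. (i) If $\vartheta$ is a $k$-spike distribution, i.e. $\vartheta=\sum_{i=1}^k p_i\delta_{\alpha_i}$ with points $\alpha_1,\dots,\alpha_k\in\Delta_n$ (not necessarily distinct) and weights $p_i\ge 0$, $\sum_{i=1}^k p_i=1$, and if $C\ge 3k/\varepsilon$, then $\vartheta(\mathcal{H})\ge 1-\varepsilon$. (ii) If $\vartheta$ is an arbitrary distribution supported in a $k$-dimensional linear subspace of $\mathbb{R}^n$ (i.e. $\vartheta(W)=1$ for some linear subspace $W$ with $\dim W=k$), and if $C\ge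 5k^2/\varepsilon$, then $\vartheta(\mathcal{H})\ge 1-\varepsilon$. -/

import Mathlib

open MeasureTheory

/-- A mixture on `[n]`: a (Borel) probability measure on `ℝⁿ` that is concentrated on the simplex
`Δ_n = {x ∈ ℝ₊ⁿ | ‖x‖₁ = 1}`. -/
structure IsMixture {n : ℕ} (ϑ : Measure (Fin n → ℝ)) : Prop where
  isProbabilityMeasure : IsProbabilityMeasure ϑ
  ae_mem_simplex : ∀ᵐ x ∂ϑ, x ∈ stdSimplex ℝ (Fin n)

/-- The 1-snapshot distribution of a mixture: `r_i = ∫ x_i ϑ(dx)`. -/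
noncomputable def oneSnapshot {n : ℕ} (ϑ : Measure (Fin n → ℝ)) (i : Fin n) : ℝ :=
  ∫ x, x i ∂ϑ

/-- The mixture is isotropic if `r_i ∈ [1/(2n), 2/n]` for every `i`. -/
def IsIsotropic {n : ℕ} (ϑ : Measure (Fin n → ℝ)) : Prop :=
  ∀ i : Fin n, oneSnapshot ϑ i ∈ Set.Icc (1 / (2 * (n : ℝ))) (2 / (n : ℝ))

/-- A `k`-spike distribution on `Δ_n`: `ϑ = ∑ i, p_i δ_{α_i}` with `k` points `α_i ∈ Δ_n` and
probability weights `p_i`. The points need not be distinct and weights may vanish, so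
that `k` is an upper bound for the number of atoms. -/
def IsSpike {n : ℕ} (k : ℕ) (ϑ : Measure (Fin n → ℝ)) : Prop :=
  ∃ (p : Fin k → ℝ) (α : Fin k → Fin n → ℝ),
    p ∈ stdSimplex ℝ (Fin k) ∧ (∀ i, α i ∈ stdSimplex ℝ (Fin n)) ∧
      ϑ = ∑ i, ENNReal.ofReal (p i) • Measure.dirac (α i)

/-- `ϑ` is supported in some `k`-dimensional linear subspace of `ℝⁿ`. -/
def IsSupportedInDim {n : ℕ} (k : ℕ) (ϑ : Measure (Fin n → ℝ)) : Prop :=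
  ∃ W : Submodule ℝ (Fin n → ℝ), Module.finrank ℝ W = k ∧ ∀ᵐ x ∂ϑ, x ∈ W

/-- The cube `[-C/n, C/n]ⁿ`. -/
def hypercube (n : ℕ) (C : ℝ) : Set (Fin n → ℝ) :=
  {x | ∀ i, x i ∈ Set.Icc (-(C / n)) (C / n)}

/-! By Markov, a fixed coordinate reaches `a / n` with probability at most `2 / a`; the point is to
apply this to few events instead of all `n` coordinates. An atom outside the cube has a large
coordinate, so `k` spikes lose at most `2k / C`. On a `k`-dimensional `W`, at most `k` coordinates,
chosen to maximize a determinant, generate the others with coefficients in `[-1, 1]`. Outside the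
cube one of them reaches `C / (k n)`, so the loss is at most `2k² / C`. -/

/-- A finite family of vectors contains at most `finrank K M` members of which every member of the
family is a linear combination with coefficients in `[-1, 1]`. -/
theorem exists_small_subfamily_bounded_coeff {ι M : Type*} [Finite ι] [AddCommGroup M]
    [Module ℝ M] [FiniteDimensional ℝ M] (v : ι → M) :
    ∃ t : Finset ι, t.card ≤ Module.finrank ℝ M ∧
      ∀ i, ∃ c : ι → ℝ, (∀ j, |c j| ≤ 1) ∧ v i = ∑ j ∈ t, c j • v j := by
  classical
  obtain ⟨κ, a, ha, hspan, hli⟩ := exists_linearIndependent' ℝ v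
  have : Finite κ := Finite.of_injective a ha
  have := Fintype.ofFinite κ
  let e := Module.Basis.span hli
  have hmem : ∀ i, v i ∈ Submodule.span ℝ (Set.range (v ∘ a)) := fun i =>
    hspan ▸ Submodule.subset_span ⟨i, rfl⟩
  let w : ι → Submodule.span ℝ (Set.range (v ∘ a)) := fun i => ⟨v i, hmem i⟩
  have hwa : w ∘ a = e := by
    funext l
    exact (Module.Basis.span_apply hli l).symm
  have : Nonempty (κ → ι) := ⟨a⟩
  obtain ⟨s, hs⟩ := Finite.exists_max fun s : κ → ι => |e.det (w ∘ s)|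
  have hpos : 0 < |e.det (w ∘ s)| := by
    refine lt_of_lt_of_le ?_ (hs a)
    simp [hwa, e.det_self]
  obtain ⟨hsli, hsspan⟩ :=
    (Module.Basis.is_basis_iff_det e).2 (isUnit_iff_ne_zero.2 (abs_pos.1 hpos))
  have hinj : Function.Injective s := fun l l' h => hsli.injective (congrArg w h)
  let b := Module.Basis.mk hsli hsspan.ge
  have hb : ∀ l, b l = w (s l) := fun l => Module.Basis.mk_apply hsli hsspan.ge l
  refine ⟨Finset.univ.image s, ?_, fun i => ?_⟩
  · exact Finset.card_image_le.trans hli.fintype_card_le_finrank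
  have hsum : w i = ∑ l, b.repr (w i) l • w (s l) := by
    simpa only [hb] using (b.sum_repr (w i)).symm
  have hcoeff : ∀ l, |b.repr (w i) l| ≤ 1 := by
    intro l
    -- Cramer's rule: the coefficient is a ratio of determinants, at most 1 in absolute value since
    -- `s` is maximal.
    have hdet : e.det (Function.update (w ∘ s) l (w i)) = b.repr (w i) l * e.det (w ∘ s) := by
      conv_lhs => rw [hsum]
      rw [AlternatingMap.map_update_sum, Finset.sum_eq_single l]
      · rw [AlternatingMap.map_update_smul, ← Function.comp_apply (f := w) (g := s),
          Function.update_eq_self, smul_eq_mul]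
      · intro m _ hm
        rw [AlternatingMap.map_update_smul, ← Function.comp_apply (f := w) (g := s),
          AlternatingMap.map_update_self _ _ hm.symm, smul_zero]
      · simp
    have hle := hs (Function.update s l i)
    rw [Function.comp_update, hdet, abs_mul] at hle
    exact le_of_mul_le_mul_right (by simpa using hle) hpos
  refine ⟨Function.extend s (b.repr (w i)) 0, fun j => ?_, ?_⟩
  · by_cases hj : ∃ l, s l = j
    · obtain ⟨l, rfl⟩ := hj
      rw [hinj.extend_apply]
      exact hcoeff l
    · simp [Function.extend_apply' _ _ _ hj]
  · rw [Finset.sum_image hinj.injOn]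
    simp only [hinj.extend_apply]
    simpa [w] using congrArg Subtype.val hsum

/-- Every coordinate of a point of a subspace `W` is bounded by the sum of the absolute values of
at most `dim W` fixed coordinates. -/
theorem Submodule.exists_finset_abs_apply_le_sum {ι : Type*} [Fintype ι]
    (W : Submodule ℝ (ι → ℝ)) :
    ∃ t : Finset ι, t.card ≤ Module.finrank ℝ W ∧ ∀ x ∈ W, ∀ i, |x i| ≤ ∑ j ∈ t, |x j| := by
  obtain ⟨t, ht, h⟩ := exists_small_subfamily_bounded_coeff
    fun i => (LinearMap.proj i : (ι → ℝ) →ₗ[ℝ] ℝ) ∘ₗ W.subtype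
  refine ⟨t, ht.trans_eq Subspace.dual_finrank_eq, fun x hx i => ?_⟩
  obtain ⟨c, hc, hi⟩ := h i
  have hxi : x i = ∑ j ∈ t, c j * x j := by simpa using LinearMap.congr_fun hi ⟨x, hx⟩
  rw [hxi]
  refine (Finset.abs_sum_le_sum_abs _ _).trans (Finset.sum_le_sum fun j _ => ?_)
  rw [abs_mul]
  exact mul_le_of_le_one_left (abs_nonneg _) (hc j)

theorem IsMixture.integrable_apply {n : ℕ} {ϑ : Measure (Fin n → ℝ)} (hmix : IsMixture ϑ)
    (i : Fin n) : Integrable (fun x => x i) ϑ := by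
  have := hmix.isProbabilityMeasure
  refine Integrable.of_bound (measurable_pi_apply i).aestronglyMeasurable 1 ?_
  filter_upwards [hmix.ae_mem_simplex] with x hx
  rw [Real.norm_of_nonneg (hx.1 i), ← hx.2]
  exact Finset.single_le_sum (fun j _ => hx.1 j) (Finset.mem_univ i)

theorem IsMixture.pos {n : ℕ} {ϑ : Measure (Fin n → ℝ)} (hmix : IsMixture ϑ) : 0 < n := by
  have := hmix.isProbabilityMeasure
  obtain ⟨x, hx⟩ := hmix.ae_mem_simplex.exists
  rcases Nat.eq_zero_or_pos n with rfl | h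
  · simpa using hx.2
  · exact h

/-- Markov's inequality for a coordinate of an isotropic mixture. -/
theorem IsMixture.measureReal_le_apply_le {n : ℕ} {ϑ : Measure (Fin n → ℝ)}
    (hmix : IsMixture ϑ) (hiso : IsIsotropic ϑ) {a : ℝ} (ha : 0 < a) (i : Fin n) :
    ϑ.real {x | a / n ≤ x i} ≤ 2 / a := by
  have hn : (0 : ℝ) < n := Nat.cast_pos.2 hmix.pos
  have hmarkov := mul_meas_ge_le_integral_of_nonneg
    (hmix.ae_mem_simplex.mono fun x hx => hx.1 i) (hmix.integrable_apply i) (a / n)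
  have hle := hmarkov.trans (hiso i).2
  rw [div_mul_eq_mul_div, div_le_div_iff_of_pos_right hn] at hle
  rwa [le_div_iff₀' ha]

/-- Union bound: if almost every point outside `s` lies in one of the sets `A j`. -/
theorem one_sub_le_measureReal_of_ae_mem_or {Ω ι : Type*} [MeasurableSpace Ω] {μ : Measure Ω}
    [IsProbabilityMeasure μ] {s : Set Ω} {t : Finset ι} {A : ι → Set Ω} {δ : ℝ}
    (hA : ∀ j ∈ t, μ.real (A j) ≤ δ) (h : ∀ᵐ x ∂μ, x ∈ s ∨ ∃ j ∈ t, x ∈ A j) :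
    1 - t.card * δ ≤ μ.real s := by
  have hone : μ.real (s ∪ ⋃ j ∈ t, A j) = 1 := by
    rw [← probReal_univ (μ := μ)]
    refine measureReal_congr (Filter.eventuallyEq_univ.2 ?_)
    filter_upwards [h] with x hx
    simpa using hx
  have hunion : μ.real (⋃ j ∈ t, A j) ≤ t.card * δ :=
    (measureReal_biUnion_finset_le t A).trans (by
      simpa [nsmul_eq_mul] using Finset.sum_le_card_nsmul t _ δ hA)
  linarith [measureReal_union_le (μ := μ) s (⋃ j ∈ t, A j)]

/-- A point of the simplex outside the cube has a large coordinate. -/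
theorem exists_le_apply_of_notMem_hypercube {n : ℕ} {C : ℝ} (hC : 0 ≤ C) {x : Fin n → ℝ}
    (hx : x ∈ stdSimplex ℝ (Fin n)) (h : x ∉ hypercube n C) : ∃ i, C / n ≤ x i := by
  by_contra! hlt
  exact h fun i => ⟨(neg_nonpos.2 (by positivity)).trans (hx.1 i), (hlt i).le⟩

theorem IsSpike.pos {n k : ℕ} {ϑ : Measure (Fin n → ℝ)} (h : IsSpike k ϑ) : 0 < k := by
  obtain ⟨p, -, hp, -⟩ := h
  rcases Nat.eq_zero_or_pos k with rfl | hk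
  · simpa using hp.2
  · exact hk

theorem IsSpike.one_sub_le_measureReal_hypercube {n k : ℕ} {ϑ : Measure (Fin n → ℝ)}
    (h : IsSpike k ϑ) (hmix : IsMixture ϑ) (hiso : IsIsotropic ϑ) {C : ℝ} (hC : 0 < C) :
    1 - k * (2 / C) ≤ ϑ.real (hypercube n C) := by
  classical
  have := hmix.isProbabilityMeasure
  obtain ⟨p, α, -, hα, hϑ⟩ := h
  have hatom : ∀ᵐ x ∂ϑ, x ∈ Set.range α := by
    rw [ae_iff, hϑ]
    simp
  -- A whole atom sits inside one Markov event, so the witnessing coordinate may depend on `j`.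
  let A : Fin k → Set (Fin n → ℝ) := fun j => if α j ∈ hypercube n C then ∅ else {α j}
  have hA : ∀ j ∈ Finset.univ, ϑ.real (A j) ≤ 2 / C := by
    intro j _
    by_cases hj : α j ∈ hypercube n C
    · simp only [A, if_pos hj, measureReal_empty]
      positivity
    · obtain ⟨i, hi⟩ := exists_le_apply_of_notMem_hypercube hC.le (hα j) hj
      simp only [A, if_neg hj]
      refine le_trans (measureReal_mono ?_) (hmix.measureReal_le_apply_le hiso hC i)
      exact Set.singleton_subset_iff.2 hi
  have hcover : ∀ᵐ x ∂ϑ, x ∈ hypercube n C ∨ ∃ j ∈ Finset.univ, x ∈ A j := by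
    filter_upwards [hatom] with x hx
    obtain ⟨j, rfl⟩ := hx
    by_cases hj : α j ∈ hypercube n C
    · exact Or.inl hj
    · exact Or.inr ⟨j, Finset.mem_univ j, by simp [A, hj]⟩
  simpa using one_sub_le_measureReal_of_ae_mem_or hA hcover

theorem IsSupportedInDim.pos {n k : ℕ} {ϑ : Measure (Fin n → ℝ)} (h : IsSupportedInDim k ϑ)
    (hmix : IsMixture ϑ) : 0 < k := by
  have := hmix.isProbabilityMeasure
  obtain ⟨W, rfl, hW⟩ := h
  obtain ⟨x, hx, hxW⟩ := (hmix.ae_mem_simplex.and hW).exists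
  refine Nat.pos_of_ne_zero fun h0 => ?_
  rw [Submodule.finrank_eq_zero.1 h0, Submodule.mem_bot] at hxW
  simpa [hxW] using hx.2

theorem IsSupportedInDim.one_sub_le_measureReal_hypercube {n k : ℕ}
    {ϑ : Measure (Fin n → ℝ)} (h : IsSupportedInDim k ϑ) (hmix : IsMixture ϑ)
    (hiso : IsIsotropic ϑ) {C : ℝ} (hC : 0 < C) :
    1 - k * (2 / (C / k)) ≤ ϑ.real (hypercube n C) := by
  have := hmix.isProbabilityMeasure
  have hk : (0 : ℝ) < k := Nat.cast_pos.2 (h.pos hmix)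
  obtain ⟨W, hWk, hW⟩ := h
  obtain ⟨t, ht, hle⟩ := W.exists_finset_abs_apply_le_sum
  rw [hWk] at ht
  have hcover : ∀ᵐ x ∂ϑ, x ∈ hypercube n C ∨ ∃ j ∈ t, x ∈ {x | C / k / n ≤ x j} := by
    filter_upwards [hmix.ae_mem_simplex, hW] with x hx hxW
    by_contra! hcon
    obtain ⟨i, hi⟩ := exists_le_apply_of_notMem_hypercube hC.le hx hcon.1
    have hn : (0 : ℝ) < n := Nat.cast_pos.2 hmix.pos
    have hlt : ∀ j ∈ t, |x j| < C / k / n := fun j hj => by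
      rw [abs_of_nonneg (hx.1 j)]
      exact hcon.2 j hj
    have hxi : C / n ≤ ∑ j ∈ t, |x j| := (hi.trans (le_abs_self _)).trans (hle x hxW i)
    -- The strict sum bound below fails for an empty `t`.
    have hne : t.Nonempty := by
      rw [Finset.nonempty_iff_ne_empty]
      rintro rfl
      exact absurd hxi (not_le.2 (by simpa using div_pos hC hn))
    have hsum : ∑ j ∈ t, |x j| < t.card * (C / k / n) := by
      simpa [nsmul_eq_mul] using Finset.sum_lt_sum_of_nonempty hne hlt
    have hcard : t.card * (C / k / n) ≤ k * (C / k / n) := by gcongr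
    have hcancel : k * (C / k / n) = C / n := by field_simp
    linarith
  refine le_trans ?_ (one_sub_le_measureReal_of_ae_mem_or
    (fun j _ => hmix.measureReal_le_apply_le hiso (div_pos hC hk) j) hcover)
  gcongr

theorem mainTheorem8 (n k : ℕ) (ϑ : Measure (Fin n → ℝ))
    (hmix : IsMixture ϑ) (hiso : IsIsotropic ϑ) (ε C : ℝ) (hε : 0 < ε) :
    (IsSpike k ϑ → 3 * (k : ℝ) / ε ≤ C → 1 - ε ≤ ϑ.real (hypercube n C)) ∧
    (IsSupportedInDim k ϑ → 5 * (k : ℝ) ^ 2 / ε ≤ C → 1 - ε ≤ ϑ.real (hypercube n C)) := by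
  refine ⟨fun h hCε => ?_, fun h hCε => ?_⟩
  -- For `k = 0` the bound on `C` would not force `C > 0`; that case is vacuous.
  · have hk : (0 : ℝ) < k := Nat.cast_pos.2 h.pos
    have hC : 0 < C := lt_of_lt_of_le (by positivity) hCε
    refine le_trans ?_ (h.one_sub_le_measureReal_hypercube hmix hiso hC)
    rw [div_le_iff₀ hε] at hCε
    have : k * (2 / C) ≤ ε := by
      rw [mul_div_assoc', div_le_iff₀ hC]
      linarith
    linarith
  · have hk : (0 : ℝ) < k := Nat.cast_pos.2 (h.pos hmix)
    have hC : 0 < C := lt_of_lt_of_le (by positivity) hCε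
    refine le_trans ?_ (h.one_sub_le_measureReal_hypercube hmix hiso hC)
    rw [div_le_iff₀ hε] at hCε
    -- The loss `2k² / C` is in fact at most `2ε / 5`.
    have : k * (2 / (C / k)) ≤ ε := by
      rw [div_div_eq_mul_div, mul_div_assoc', div_le_iff₀ hC]
      nlinarith
    linarith
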